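/- Let \(d,s\ge 0\) be integers and let \(f=(f_1,\dots,f_s)\) be a finite family of polynomials in \(\mathbb{R}[x_1,\dots,x_d]\). Put \[ K(f)=\{x\in\mathbb{R}^d : f_i(x)\ge 0 \text{ for } i=1,\dots,s\}, \qquad T(f)=\Bigl\{\sum_{e\in\{0,1\}^s}\sigma_e\, f_1^{e_1}\cdots f_s^{e_s} : \text{each } \sigma_e \text{ is a finite sum of squares in } \mathbb{R}[x_1,\dots,x_d]\Bigr\}. \] Assume that the preordering \(T(f)\) is Archimedean, that is, for every \(p\in\mathbb{R}[x_1,\dots,x_d]\) there is a real \(\lambda>0\) with \(\lambda+p\in T(f)\) and \(\lambda-p\in T(f)\). Let \(L:\mathbb{R}[x_1,\dots,x_d]\to\mathbb{R}\) be a linear functional that is \(T(f)\)-positive, that is, \(L(p)\ge 0\) for all \(p\in T(f)\). Then \(L\) is a \(K(f)\)-moment functional: there exists a nonnegative Radon measure \(\mu\) on \(\mathbb{R}^d\) with \(\operatorname{supp}\mu\subseteq K(f)\) such that every polynomial \(p\in\mathbb{R}[x_1,\dots,x_d]\) is \(\mu\)-integrable on \(K(f)\) and \[ L(p)=\int_{K(f)}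 p\,d\mu . \] -/

import Mathlib

open MeasureTheory

namespace MomentProblem

/-- The set of `Q`-bounded elements: those `a` with `lam + a ∈ Q` and `lam - a ∈ Q` for some real
`lam > 0`. -/
def boundedElements {A : Type*} [CommRing A] [Algebra ℝ A] (Q : Set A) : Set A :=
  {a | ∃ lam : ℝ, 0 < lam ∧ algebraMap ℝ A lam + a ∈ Q ∧ algebraMap ℝ A lam - a ∈ Q}

/-- `Q` (a quadratic module or a preordering) is Archimedean if every element of the algebra is
`Q`-bounded. -/
def IsArchimedean {A : Type*} [CommRing A] [Algebra ℝ A] (Q : Set A) : Prop :=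
  boundedElements Q = Set.univ

/-- The basic closed semialgebraic set `K(f) = {x ∈ ℝ^d : f_i(x) ≥ 0 for all i}`. -/
def basicClosedSet {d s : ℕ} (f : Fin s → MvPolynomial (Fin d) ℝ) : Set (Fin d → ℝ) :=
  {x | ∀ i, 0 ≤ MvPolynomial.eval x (f i)}

/-- The preordering `T(f)` generated by `f`: all sums, over exponents `e ∈ {0,1}^s`, of
`σ_e f_1^{e_1} ⋯ f_s^{e_s}` with each `σ_e` a sum of squares. -/
def preorderingOf {d s : ℕ} (f : Fin s → MvPolynomial (Fin d) ℝ) :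
    Set (MvPolynomial (Fin d) ℝ) :=
  {p | ∃ σ : (Fin s → Fin 2) → MvPolynomial (Fin d) ℝ,
    (∀ e, IsSumSq (σ e)) ∧ p = ∑ e, σ e * ∏ i, f i ^ (e i : ℕ)}

/-- The linear functional `L` is nonnegative on the set `Q`. -/
def IsPositiveOn {A : Type*} [CommRing A] [Algebra ℝ A] (Q : Set A) (L : A →ₗ[ℝ] ℝ) : Prop :=
  ∀ p ∈ Q, 0 ≤ L p

/-- `μ` is a representing measure for `L` on `K`: a Radon measure on `ℝ^d` (a regular Borel
measure, finite on compact sets) whose support lies in `K`, for which every polynomial is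
integrable on `K` with integral `L p`. -/
structure IsRepresentingMeasure {d : ℕ} (K : Set (Fin d → ℝ))
    (L : MvPolynomial (Fin d) ℝ →ₗ[ℝ] ℝ) (μ : Measure (Fin d → ℝ)) : Prop where
  regular : μ.Regular
  support_subset : μ.support ⊆ K
  integrableOn : ∀ p : MvPolynomial (Fin d) ℝ,
    IntegrableOn (fun x => MvPolynomial.eval x p) K μ
  eq_integral : ∀ p : MvPolynomial (Fin d) ℝ, L p = ∫ x in K, MvPolynomial.eval x p ∂μ

/-- `L` is a `K`-moment functional: it has a representing measure supported on `K`. -/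
def IsMomentFunctional {d : ℕ} (K : Set (Fin d → ℝ))
    (L : MvPolynomial (Fin d) ℝ →ₗ[ℝ] ℝ) : Prop :=
  ∃ μ : Measure (Fin d → ℝ), IsRepresentingMeasure K L μ

end MomentProblem

/-! The normalized `T(f)`-positive functionals form a convex set, compact for pointwise convergence
because the Archimedean property bounds each value. Its extreme points are multiplicative
(`map_mul_of_mem_extremePoints`), hence evaluations at points of `K(f)`. By Krein–Milman every state
lies in the closed convex hull of these evaluations. Integrals against probability measures on the
compact set `K(f)` form a compact convex set containing them, hence containing all states. -/

namespace MomentProblem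

section Algebra

variable {A : Type*} [CommRing A] [Algebra ℝ A]

/-- The normalized `Q`-positive functionals, as functions on `A`. -/
def states (Q : Set A) : Set (A → ℝ) :=
  {φ | ∃ L : A →ₗ[ℝ] ℝ, IsPositiveOn Q L ∧ L 1 = 1 ∧ ⇑L = φ}

theorem map_algebraMap (L : A →ₗ[ℝ] ℝ) (c : ℝ) : L (algebraMap ℝ A c) = c * L 1 := by
  rw [Algebra.algebraMap_eq_smul_one, map_smul, smul_eq_mul]

theorem IsArchimedean.exists_abs_le {Q : Set A} (hQ : IsArchimedean Q) (a : A) :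
    ∃ c : ℝ, ∀ L : A →ₗ[ℝ] ℝ, IsPositiveOn Q L → |L a| ≤ c * L 1 := by
  obtain ⟨c, -, h₁, h₂⟩ := hQ.symm ▸ Set.mem_univ a
  refine ⟨c, fun L hL ↦ abs_le.2 ?_⟩
  have h₃ := hL _ h₁
  have h₄ := hL _ h₂
  rw [map_add, map_algebraMap] at h₃
  rw [map_sub, map_algebraMap] at h₄
  constructor <;> linarith

theorem convex_states (Q : Set A) : Convex ℝ (states Q) := by
  rintro _ ⟨L, hL, hL1, rfl⟩ _ ⟨M, hM, hM1, rfl⟩ a b ha hb hab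
  refine ⟨a • L + b • M, fun p hp ↦ ?_, by simp [hL1, hM1, hab], by ext; simp⟩
  exact add_nonneg (mul_nonneg ha (hL p hp)) (mul_nonneg hb (hM p hp))

theorem isCompact_states {Q : Set A} (hQ : IsArchimedean Q) : IsCompact (states Q) := by
  choose c hc using hQ.exists_abs_le
  refine (isCompact_univ_pi fun a ↦ isCompact_Icc (a := -c a) (b := c a)).of_isClosed_subset ?_ ?_
  · have : states Q = Set.range ((↑) : (A →ₗ[ℝ] ℝ) → A → ℝ) ∩
        ({φ | ∀ p ∈ Q, 0 ≤ φ p} ∩ {φ | φ 1 = 1}) := by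
      ext φ
      constructor
      · rintro ⟨L, hL, hL1, rfl⟩
        exact ⟨⟨L, rfl⟩, hL, hL1⟩
      · rintro ⟨⟨L, rfl⟩, hL, hL1⟩
        exact ⟨L, hL, hL1, rfl⟩
    rw [this]
    refine (LinearMap.isClosed_range_coe A ℝ (RingHom.id ℝ)).inter (IsClosed.inter ?_ ?_)
    · simp only [Set.ofPred_forall]
      exact isClosed_iInter fun p ↦ isClosed_iInter fun _ ↦
        isClosed_le continuous_const (continuous_apply p)
    · exact isClosed_eq (continuous_apply 1) continuous_const
  · rintro _ ⟨L, hL, hL1, rfl⟩ a -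
    simpa [hL1, abs_le] using hc a L hL

theorem smul_mulLeft_mem_states {Q : Set A} (hmul : ∀ p ∈ Q, ∀ q ∈ Q, p * q ∈ Q)
    {L : A →ₗ[ℝ] ℝ} (hL : IsPositiveOn Q L) {u : A} (hu : u ∈ Q) (hLu : 0 < L u) :
    (fun a ↦ (L u)⁻¹ * L (u * a)) ∈ states Q :=
  ⟨(L u)⁻¹ • L ∘ₗ LinearMap.mulLeft ℝ u,
    fun p hp ↦ mul_nonneg (inv_nonneg.2 hLu.le) (hL _ (hmul u hu p hp)),
    by simp [hLu.ne'], by ext; simp⟩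

/-- Since `u + v = 2(c + 1)`, `L` is a convex combination of the states `L(u·)/L(u)` and
`L(v·)/L(v)`. Extremality makes the first equal to `L`, which rearranges to multiplicativity. -/
theorem map_mul_of_mem_extremePoints {Q : Set A} (hQ : IsArchimedean Q)
    (hmul : ∀ p ∈ Q, ∀ q ∈ Q, p * q ∈ Q) (hadd : ∀ p ∈ Q, ∀ q ∈ Q, p + q ∈ Q) (hone : 1 ∈ Q)
    {φ : A → ℝ} (hφ : φ ∈ (states Q).extremePoints ℝ) (b a : A) : φ (b * a) = φ b * φ a := by
  obtain ⟨⟨L, hL, hL1, rfl⟩, hext⟩ := hφ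
  obtain ⟨c, hc, h₁, h₂⟩ := hQ.symm ▸ Set.mem_univ b
  -- The extra `1` makes `L u` and `L v` strictly positive, so both can be divided by.
  have hu := hadd _ h₁ _ hone
  have hv := hadd _ h₂ _ hone
  set u := algebraMap ℝ A c + b + 1 with hu_def
  set v := algebraMap ℝ A c - b + 1 with hv_def
  have hLu : L u = c + L b + 1 := by simp [hu_def, map_algebraMap, hL1]
  have hLv : L v = c - L b + 1 := by simp [hv_def, map_algebraMap, hL1]
  have hu0 : 0 < L u := by
    have := hL _ h₁
    rw [map_add, map_algebraMap, hL1] at this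
    linarith
  have hv0 : 0 < L v := by
    have := hL _ h₂
    rw [map_sub, map_algebraMap, hL1] at this
    linarith
  have hua (x : A) : L (u * x) = (c + 1) * L x + L (b * x) := by
    simp only [hu_def, add_mul, map_add, one_mul, ← Algebra.smul_def, map_smul, smul_eq_mul]
    ring
  have hva (x : A) : L (v * x) = (c + 1) * L x - L (b * x) := by
    simp only [hv_def, add_mul, sub_mul, map_add, map_sub, one_mul, ← Algebra.smul_def, map_smul,
      smul_eq_mul]
    ring
  have key := hext (smul_mulLeft_mem_states hmul hL hu hu0)
    (smul_mulLeft_mem_states hmul hL hv hv0)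
    ⟨L u / (2 * (c + 1)), L v / (2 * (c + 1)), by positivity, by positivity, by
      rw [hLu, hLv]; field_simp; ring, by
      ext x
      simp only [Pi.add_apply, Pi.smul_apply, smul_eq_mul, hua, hva]
      field_simp
      ring⟩
  have := congrFun key a
  simp only [hua] at this
  rw [inv_mul_eq_iff_eq_mul₀ hu0.ne', hLu] at this
  linarith

end Algebra

variable {d s : ℕ} {f : Fin s → MvPolynomial (Fin d) ℝ}

theorem add_mem_preorderingOf {p q : MvPolynomial (Fin d) ℝ} (hp : p ∈ preorderingOf f)
    (hq : q ∈ preorderingOf f) : p + q ∈ preorderingOf f := by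
  obtain ⟨σ, hσ, rfl⟩ := hp
  obtain ⟨τ, hτ, rfl⟩ := hq
  exact ⟨σ + τ, fun e ↦ (hσ e).add (hτ e), by simp [add_mul, Finset.sum_add_distrib]⟩

theorem sum_mem_preorderingOf {ι : Type*} (t : Finset ι) {p : ι → MvPolynomial (Fin d) ℝ}
    (hp : ∀ i ∈ t, p i ∈ preorderingOf f) : ∑ i ∈ t, p i ∈ preorderingOf f :=
  Finset.sum_induction p (· ∈ preorderingOf f) (fun _ _ ↦ add_mem_preorderingOf)
    ⟨0, fun _ ↦ IsSumSq.zero, by simp⟩ hp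

/-- Reduce exponents mod 2: the even part is a square, absorbed into `σ`. -/
theorem mul_prod_pow_mem_preorderingOf {σ : MvPolynomial (Fin d) ℝ} (hσ : IsSumSq σ)
    (n : Fin s → ℕ) : σ * ∏ i, f i ^ n i ∈ preorderingOf f := by
  classical
  set e₀ : Fin s → Fin 2 := fun i ↦ ⟨n i % 2, Nat.mod_lt _ two_pos⟩ with he₀
  have hsq : IsSumSq ((∏ i, f i ^ (n i / 2)) * ∏ i, f i ^ (n i / 2)) :=
    IsSumSq.mul_self _
  refine ⟨Pi.single e₀ (σ * ((∏ i, f i ^ (n i / 2)) * ∏ i, f i ^ (n i / 2))), fun e ↦ ?_, ?_⟩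
  · obtain rfl | h := eq_or_ne e e₀
    · simpa using hσ.mul hsq
    · simp [h]
  · rw [Finset.sum_eq_single e₀ (fun e _ h ↦ by simp [h]) (by simp), Pi.single_eq_same, mul_assoc,
      ← Finset.prod_mul_distrib, ← Finset.prod_mul_distrib]
    congr 1
    refine Finset.prod_congr rfl fun i _ ↦ ?_
    rw [← pow_add, ← pow_add]
    congr 1
    simp only [he₀]
    omega

theorem mul_mem_preorderingOf {p q : MvPolynomial (Fin d) ℝ} (hp : p ∈ preorderingOf f)
    (hq : q ∈ preorderingOf f) : p * q ∈ preorderingOf f := by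
  obtain ⟨σ, hσ, rfl⟩ := hp
  obtain ⟨τ, hτ, rfl⟩ := hq
  rw [Finset.sum_mul_sum]
  refine sum_mem_preorderingOf _ fun e _ ↦ sum_mem_preorderingOf _ fun e' _ ↦ ?_
  rw [mul_mul_mul_comm, ← Finset.prod_mul_distrib]
  simp only [← pow_add]
  exact mul_prod_pow_mem_preorderingOf ((hσ e).mul (hτ e')) _

theorem one_mem_preorderingOf : 1 ∈ preorderingOf f := by
  simpa using mul_prod_pow_mem_preorderingOf (f := f) (IsSquare.one.isSumSq) 0

theorem generator_mem_preorderingOf (i : Fin s) : f i ∈ preorderingOf f := by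
  classical
  have := mul_prod_pow_mem_preorderingOf (f := f) (IsSquare.one.isSumSq) (Pi.single i 1)
  rwa [one_mul, Finset.prod_eq_single i (fun j _ h ↦ by simp [h]) (by simp), Pi.single_eq_same,
    pow_one] at this

theorem eval_nonneg_of_isSumSq {p : MvPolynomial (Fin d) ℝ} (hp : IsSumSq p) (x : Fin d → ℝ) :
    0 ≤ MvPolynomial.eval x p := by
  induction hp with
  | zero => simp
  | sq_add a _ ih =>
    rw [map_add, map_mul]
    exact add_nonneg (mul_self_nonneg _) ih

theorem eval_nonneg_of_mem_preorderingOf {p : MvPolynomial (Fin d) ℝ} (hp : p ∈ preorderingOf f)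
    {x : Fin d → ℝ} (hx : x ∈ basicClosedSet f) : 0 ≤ MvPolynomial.eval x p := by
  obtain ⟨σ, hσ, rfl⟩ := hp
  rw [map_sum]
  refine Finset.sum_nonneg fun e _ ↦ ?_
  rw [map_mul, map_prod]
  refine mul_nonneg (eval_nonneg_of_isSumSq (hσ e) x) (Finset.prod_nonneg fun i _ ↦ ?_)
  rw [map_pow]
  exact pow_nonneg (hx i) _

theorem isClosed_basicClosedSet (f : Fin s → MvPolynomial (Fin d) ℝ) :
    IsClosed (basicClosedSet f) := by
  simp only [basicClosedSet, Set.ofPred_forall]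
  exact isClosed_iInter fun i ↦ isClosed_le continuous_const (MvPolynomial.continuous_eval _)

theorem isCompact_basicClosedSet (hf : IsArchimedean (preorderingOf f)) :
    IsCompact (basicClosedSet f) := by
  have (i : Fin d) : ∃ c : ℝ, ∀ x ∈ basicClosedSet f, x i ∈ Set.Icc (-c) c := by
    obtain ⟨c, -, h₁, h₂⟩ := hf.symm ▸ Set.mem_univ (MvPolynomial.X i : MvPolynomial (Fin d) ℝ)
    refine ⟨c, fun x hx ↦ ?_⟩
    have h₃ := eval_nonneg_of_mem_preorderingOf h₁ hx
    have h₄ := eval_nonneg_of_mem_preorderingOf h₂ hx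
    simp only [MvPolynomial.algebraMap_eq, map_add, map_sub, MvPolynomial.eval_C,
      MvPolynomial.eval_X] at h₃ h₄
    constructor <;> linarith
  choose c hc using this
  exact (isCompact_univ_pi fun i ↦ isCompact_Icc (a := -c i) (b := c i)).of_isClosed_subset
    (isClosed_basicClosedSet f) fun x hx i _ ↦ hc i x hx

/-- The extreme normalized functionals nonnegative on an Archimedean preordering are evaluations. -/
theorem exists_eval_of_mem_extremePoints (hf : IsArchimedean (preorderingOf f))
    {φ : MvPolynomial (Fin d) ℝ → ℝ} (hφ : φ ∈ (states (preorderingOf f)).extremePoints ℝ) :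
    ∃ x ∈ basicClosedSet f, φ = fun p ↦ MvPolynomial.eval x p := by
  have hmul := map_mul_of_mem_extremePoints hf (fun p hp q hq ↦ mul_mem_preorderingOf hp hq)
    (fun p hp q hq ↦ add_mem_preorderingOf hp hq) one_mem_preorderingOf hφ
  obtain ⟨⟨L, hL, hL1, rfl⟩, -⟩ := hφ
  have heval (p : MvPolynomial (Fin d) ℝ) :
      L p = MvPolynomial.eval (fun i ↦ L (MvPolynomial.X i)) p := by
    -- A unital multiplicative linear map is an algebra homomorphism, so its values on the variables
    -- determine it.
    rw [← MvPolynomial.coe_aeval_eq_eval]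
    exact DFunLike.congr_fun (MvPolynomial.aeval_unique (AlgHom.ofLinearMap L hL1 hmul)) p
  refine ⟨_, fun i ↦ ?_, funext heval⟩
  rw [← heval]
  exact hL _ (generator_mem_preorderingOf i)

theorem integrable_of_compactSpace {X : Type*} [TopologicalSpace X] [CompactSpace X]
    [MeasurableSpace X] [OpensMeasurableSpace X] (μ : Measure X) [IsFiniteMeasure μ] {g : X → ℝ}
    (hg : Continuous g) : Integrable g μ :=
  (BoundedContinuousFunction.mkOfCompact ⟨g, hg⟩).integrable μ

/-- The functional of integration of polynomials against a probability measure on `K`. -/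
noncomputable def integralFunctional (K : Set (Fin d → ℝ)) (μ : ProbabilityMeasure K) :
    MvPolynomial (Fin d) ℝ → ℝ :=
  fun p ↦ ∫ x, MvPolynomial.eval (x : Fin d → ℝ) p ∂(μ : Measure K)

theorem continuous_eval_coe (K : Set (Fin d → ℝ)) (p : MvPolynomial (Fin d) ℝ) :
    Continuous fun x : K ↦ MvPolynomial.eval (x : Fin d → ℝ) p :=
  (MvPolynomial.continuous_eval p).comp continuous_subtype_val

theorem continuous_integralFunctional (K : Set (Fin d → ℝ)) [CompactSpace K] :
    Continuous (integralFunctional K) :=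
  continuous_pi fun p ↦ ProbabilityMeasure.continuous_integral_boundedContinuousFunction
    (BoundedContinuousFunction.mkOfCompact ⟨_, continuous_eval_coe K p⟩)

theorem convex_range_integralFunctional (K : Set (Fin d → ℝ)) [CompactSpace K] :
    Convex ℝ (Set.range (integralFunctional K)) := by
  rintro _ ⟨μ, rfl⟩ _ ⟨ν, rfl⟩ a b ha hb hab
  have hprob : IsProbabilityMeasure
      (ENNReal.ofReal a • (μ : Measure K) + ENNReal.ofReal b • (ν : Measure K)) :=
    ⟨by simp [← ENNReal.ofReal_add ha hb, hab]⟩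
  refine ⟨⟨_, hprob⟩, funext fun p ↦ ?_⟩
  have hint (ρ : ProbabilityMeasure K) :=
    integrable_of_compactSpace (ρ : Measure K) (continuous_eval_coe K p)
  simp only [integralFunctional, ProbabilityMeasure.coe_mk, Pi.add_apply, Pi.smul_apply]
  rw [integral_add_measure ((hint μ).smul_measure ENNReal.ofReal_ne_top)
    ((hint ν).smul_measure ENNReal.ofReal_ne_top), integral_smul_measure, integral_smul_measure,
    ENNReal.toReal_ofReal ha, ENNReal.toReal_ofReal hb]

theorem states_subset_range_integralFunctional (hf : IsArchimedean (preorderingOf f)) :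
    states (preorderingOf f) ⊆ Set.range (integralFunctional (basicClosedSet f)) := by
  have : CompactSpace (basicClosedSet f) :=
    isCompact_iff_compactSpace.1 (isCompact_basicClosedSet hf)
  rw [← closure_convexHull_extremePoints (isCompact_states hf) (convex_states _)]
  -- The range is closed because the probability measures on a compact space form a compact space.
  refine closure_minimal (convexHull_min ?_ (convex_range_integralFunctional _))
    (isCompact_range (continuous_integralFunctional _)).isClosed
  intro φ hφ
  obtain ⟨x, hx, rfl⟩ := exists_eval_of_mem_extremePoints hf hφ
  refine ⟨⟨Measure.dirac ⟨x, hx⟩, inferInstance⟩, funext fun p ↦ ?_⟩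
  simp [integralFunctional]

theorem isRepresentingMeasure_map_coe {K : Set (Fin d → ℝ)} (hK : IsCompact K)
    {L : MvPolynomial (Fin d) ℝ →ₗ[ℝ] ℝ} (μ : Measure K) [IsFiniteMeasure μ]
    (hμ : ∀ p, L p = ∫ x, MvPolynomial.eval (x : Fin d → ℝ) p ∂μ) :
    IsRepresentingMeasure K L (μ.map (↑)) := by
  have : CompactSpace K := isCompact_iff_compactSpace.1 hK
  have hemb : MeasurableEmbedding ((↑) : K → Fin d → ℝ) :=
    MeasurableEmbedding.subtype_coe hK.isClosed.measurableSet
  have hae : ∀ᵐ x ∂μ.map (↑), x ∈ K := hemb.ae_map_iff.2 (.of_forall fun x ↦ x.2)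
  have hrestrict : (μ.map ((↑) : K → Fin d → ℝ)).restrict K = μ.map (↑) :=
    Measure.restrict_eq_self_of_ae_mem hae
  refine ⟨inferInstance, Measure.support_subset_of_isClosed hK.isClosed hae, fun p ↦ ?_, fun p ↦ ?_⟩
  · rw [IntegrableOn, hrestrict, hemb.integrable_map_iff]
    exact integrable_of_compactSpace μ (continuous_eval_coe K p)
  · rw [hrestrict, hemb.integral_map, hμ]

end MomentProblem

open MomentProblem in
theorem mainTheorem3 {d s : ℕ} (f : Fin s → MvPolynomial (Fin d) ℝ)
    (hf : MomentProblem.IsArchimedean (MomentProblem.preorderingOf f))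
    (L : MvPolynomial (Fin d) ℝ →ₗ[ℝ] ℝ)
    (hL : MomentProblem.IsPositiveOn (MomentProblem.preorderingOf f) L) :
    MomentProblem.IsMomentFunctional (MomentProblem.basicClosedSet f) L := by
  have hK := isCompact_basicClosedSet hf
  have hL1 : 0 ≤ L 1 := hL 1 one_mem_preorderingOf
  obtain h0 | hpos := hL1.eq_or_lt
  -- If `L 1 = 0`, the bound `|L p| ≤ c * L 1` forces `L = 0`.
  · refine ⟨_, isRepresentingMeasure_map_coe hK 0 fun p ↦ ?_⟩
    obtain ⟨c, hc⟩ := hf.exists_abs_le p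
    simpa [← h0] using hc L hL
  · obtain ⟨μ, hμ⟩ := states_subset_range_integralFunctional hf
      ⟨(L 1)⁻¹ • L, fun p hp ↦ mul_nonneg (inv_nonneg.2 hL1) (hL p hp), by simp [hpos.ne'], rfl⟩
    refine ⟨_, isRepresentingMeasure_map_coe hK ((L 1).toNNReal • (μ : Measure _)) fun p ↦ ?_⟩
    have := congrFun hμ p
    simp only [integralFunctional, LinearMap.smul_apply, smul_eq_mul] at this
    rw [integral_smul_nnreal_measure, this, NNReal.smul_def, Real.coe_toNNReal _ hL1, smul_eq_mul,
      mul_inv_cancel_left₀ hpos.ne']
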